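/- Let $K$ be a nontrivial torsion-free abelian group of finite rank and let $T$ be an automorphism of $K$ which is hyperbolic, i.e. no complex eigenvalue of $T\otimes\mathbb{C}$ on $K\otimes\mathbb{C}$ has absolute value $1$. Regard $K$ as a $\mathbb{Z}[t,t^{-1}]$-module with $t$ acting by $T$. Let $L\subseteq K$ be a full-rank lattice (a finitely generated subgroup of the same rank as $K$) with $TL\subseteq L$ and $\bigcup_{i\in\mathbb{Z}}T^iL=K$. Then $K$ has a finite strongly $t$-logarithmic $t$-generating set. More precisely, let $A$ be any basis of $L$ and let $B=\bigcup_{i\in\mathbb{Z}}T^iA\subseteq K$. Then there is $N\in\mathbb{N}$ such that, whenever $w\in\mathbb{Z}^B$ (the free abelian group on $B$) has minimal word length among all elements of $\mathbb{Z}^B$ representing the same element of $K$, every coefficient of $w$ has absolute value less than $N$. For every $N$ with this property, the finite set $$A'=\Big\{\sum_{a\in A}i_a a \;:\; i_a\in\mathbb{Z},\ |i_a|<N \text{ for all } a\in A\Big\}$$ is a strongly $t$-logarithmic $t$-generating set for $K$. Definitions. Let $0\in A\subseteq K$. A $t$-word in $A$ is a formal expression $v=\sum_{i\in\mathbb{Z}}t^ia_i$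 with all $a_i\in A$ and all but finitely many $a_i=0$. It represents $\pi(v)=\sum_iT^ia_i\in K$, and its length is the number of $i$ with $a_i\neq0$. It is minimal if no $t$-word obtained from it by replacing at least one nonzero $a_i$ by $0$ represents the same element of $K$. The set $A$ is a $t$-generating set if every element of $K$ is represented by a $t$-word in $A$, and it is symmetrized if $A=-A$. A generalized $t$-word in $A$ is an element $w$ of the free abelian group on $\bigsqcup_{i\in\mathbb{Z}}t^iA$. It also represents an element $\pi(w)\in K$. Write $w_i$ for the part of $w$ consisting of letters in $t^iA$, and put $\|w\|_m=\sum_i\max(\|w_i\|-m,0)$, where $\|w_i\|$ is the word length. For $v$ a $t$-word or a generalized $t$-word, $I_{\max}(v)$ and $I_{\min}(v)$ are the largest and the smallest $i$ for which $t^i$ has a nonzero formal coefficient in $v$ (equal to $-\infty$ and $+\infty$ respectively if $v$ is empty). A symmetrized $t$-generating set $A$ with $0\in A$ is strongly $t$-logarithmic if for all integers $m\ge1$ and $n\ge0$ there are $B_{m,n},C_{m,n}\in\mathbb{Z}$ such that, for every nonempty generalized $t$-word $w$ in $A$ and every minimal $t$-word $w'$ in $A$ which represents $\pi(w)$ and whose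 length exceeds by at most $n$ the minimal length of a $t$-word in $A$ representing $\pi(w)$, $$I_{\max}(w')-I_{\max}(w)<B_{m,n}\log(\|w\|_m+1)+C_{m,n}\quad\text{and}\quad I_{\min}(w)-I_{\min}(w')<B_{m,n}\log(\|w\|_m+1)+C_{m,n}.$$ -/

import Mathlib

open scoped TensorProduct

noncomputable section

namespace TLog

/-- The maximal exponent `i` such that `t ^ i` has a nonzero coefficient in the formal
expression `∑ i, t ^ i * v i`; it is `-∞` for the empty expression. -/
def iMax {M : Type*} [Zero M] (v : ℤ →₀ M) : EReal :=
  ⨆ i ∈ v.support, ((i : ℝ) : EReal)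

/-- The minimal exponent `i` such that `t ^ i` has a nonzero coefficient in the formal
expression `∑ i, t ^ i * v i`; it is `+∞` for the empty expression. -/
def iMin {M : Type*} [Zero M] (v : ℤ →₀ M) : EReal :=
  ⨅ i ∈ v.support, ((i : ℝ) : EReal)

section Words

variable {K : Type*} [AddCommGroup K]

/-- `v` is a `t`-word in `A`: a formal expression `∑ i, t ^ i * a i` with all `a i` in `A`, all but
finitely many of them zero. Zero terms are not counted as letters. -/
def IsTWord (A : Set K) (v : ℤ →₀ K) : Prop :=
  ∀ i, v i ∈ A

/-- The element of `K` represented by a `t`-word, where `t` acts on `K` by `T`. -/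
def tEval (T : K ≃ₗ[ℤ] K) (v : ℤ →₀ K) : K :=
  v.sum fun i a => (T ^ i) a

/-- The length of a `t`-word: the number of its letters. -/
def tLength (v : ℤ →₀ K) : ℕ :=
  v.support.card

/-- `u` is obtained from `v` by deleting letters. -/
def IsSubword (u v : ℤ →₀ K) : Prop :=
  ∀ i, u i = 0 ∨ u i = v i

/-- `v` is a `t`-word in `A` which is minimal under inclusion among all `t`-words in `A`
representing the same element of `K`. -/
def IsMinimalTWord (T : K ≃ₗ[ℤ] K) (A : Set K) (v : ℤ →₀ K) : Prop :=
  IsTWord A v ∧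
    ∀ u : ℤ →₀ K, IsTWord A u → IsSubword u v → tEval T u = tEval T v → u = v

/-- Generalized `t`-words in `A`: the free abelian group on the disjoint union over `i : ℤ` of
the sets `t ^ i A`. The component `w i` is the subword of the letters in `t ^ i A`. -/
abbrev GenTWord (A : Set K) : Type _ :=
  ℤ →₀ (A →₀ ℤ)

/-- The element of `K` represented by a generalized `t`-word. -/
def genEval (T : K ≃ₗ[ℤ] K) {A : Set K} (w : GenTWord A) : K :=
  w.sum fun i f => f.sum fun a n => n • (T ^ i) (a : K)

/-- The word length (`ℓ¹` norm) of an element of a free abelian group. -/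
def wordLength {X : Type*} (f : X →₀ ℤ) : ℕ :=
  f.sum fun _ n => n.natAbs

/-- `∑ i, max (‖w i‖ - m, 0)`; the subtraction is the truncated one of `ℕ`. -/
def excess (m : ℕ) {A : Set K} (w : GenTWord A) : ℕ :=
  w.sum fun _ f => wordLength f - m

/-- The `t`-span of `A`: the set of all elements represented by some `t`-word in `A`. -/
def tSpan (T : K ≃ₗ[ℤ] K) (A : Set K) : Set K :=
  {k | ∃ v : ℤ →₀ K, IsTWord A v ∧ tEval T v = k}

/-- `A` is a `t`-generating set. -/
def IsTGenerating (T : K ≃ₗ[ℤ] K) (A : Set K) : Prop :=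
  tSpan T A = Set.univ

/-- `A` is a strongly `t`-logarithmic (symmetrized) `t`-generating set (containing `0`) for the
`ℤ[t, t⁻¹]`-module `K`, where `t` acts by `T`. -/
structure IsStronglyTLogarithmic (T : K ≃ₗ[ℤ] K) (A : Set K) : Prop where
  zero_mem : (0 : K) ∈ A
  symmetrized : ∀ a : K, a ∈ A ↔ -a ∈ A
  generating : IsTGenerating T A
  log_bound : ∀ m n : ℕ, 1 ≤ m → ∃ B C : ℤ,
    ∀ w : GenTWord A, w ≠ 0 →
    ∀ w' : ℤ →₀ K, IsMinimalTWord T A w' → tEval T w' = genEval T w →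
      (∀ v : ℤ →₀ K, IsTWord A v → tEval T v = genEval T w → tLength w' ≤ tLength v + n) →
      iMax w' - iMax w < ((B * Real.log (excess m w + 1) + C : ℝ) : EReal) ∧
      iMin w - iMin w' < ((B * Real.log (excess m w + 1) + C : ℝ) : EReal)

/-- `T` is hyperbolic: no complex eigenvalue of `T` (that is, of `T ⊗ ℂ` on `K ⊗ ℂ`) has
absolute value `1`. -/
def IsHyperbolic (T : K ≃ₗ[ℤ] K) : Prop :=
  ∀ μ : ℂ,
    Module.End.HasEigenvalue
      (LinearMap.baseChange ℂ (T : K →ₗ[ℤ] K)) μ → ‖μ‖ ≠ 1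

/-- The subset `⋃ i, T ^ i A` of `K`. -/
def translates (T : K ≃ₗ[ℤ] K) (A : Set K) : Set K :=
  ⋃ i : ℤ, (T ^ i) '' A

/-- The projection from `ℤ^B`, the free abelian group on a subset `B` of `K`, to `K`. -/
def freeEval {B : Set K} (w : B →₀ ℤ) : K :=
  w.sum fun b n => n • (b : K)

/-- With `B = ⋃ i, T ^ i A`: in every word `w ∈ ℤ^B` which has minimal length among the words
representing the same element of `K`, every coefficient has absolute value less than `N`. -/
def BoundsCoefficients (T : K ≃ₗ[ℤ] K) (A : Set K) (N : ℕ) : Prop :=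
  ∀ w : translates T A →₀ ℤ,
    (∀ v : translates T A →₀ ℤ, freeEval v = freeEval w → wordLength w ≤ wordLength v) →
    ∀ b, |w b| < N

/-- The set of all sums `∑ a ∈ A, c a • a` with integers `|c a| < N`. -/
def coefficientBox (A : Finset K) (N : ℕ) : Set K :=
  {k | ∃ c : K → ℤ, (∀ a ∈ A, |c a| < N) ∧ k = ∑ a ∈ A, c a • a}

end Words

end TLog

end

/-!
The idea is that hyperbolicity becomes a statement about a single integer polynomial. Since no
eigenvalue of `T` has absolute value `1`, the characteristic polynomial of `T` on `L` divides some
`q ∈ ℤ[X]` having a *dominant* coefficient, one that exceeds in absolute value the sum of the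
absolute values of all others (`exists_dominant_multiple`): for large `n`, the polynomial
`∏ (X ^ n - λ ^ n)` over the eigenvalues `λ` is dominated by the coefficient to which all the
eigenvalues outside the unit circle contribute. Taking `n` to be a power of two, it has integral
coefficients by iterating `p(X) p(-X)`. As `⋃ i, T ^ i L = K`, also `q(T) = 0` on `K`.

Subtracting the relation `q(T) T ^ (-j) b = 0` shortens any word in `ℤ^B` that has a large
coefficient at `b`; this bounds the coefficients of words of minimal length
(`boundsCoefficients_of_dominant`), and makes the coefficient box a `t`-generating set.

The same relation gives a maximum principle, which replaces the splitting of `K ⊗ ℝ` into a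
contracting and an expanding part. If `y p = T (y (p + 1) + c (p + 1))` in `L`, then `q(T) = 0`
expresses the dominant multiple of `y p` by the other multiples of nearby `y i` and by nearby `c i`,
so a bounded solution `y` is bounded by `c`, and it decays exponentially to the scale of the nearby
values of `c` (`exists_recurrence_bound`). For a generalized `t`-word `w` and a `t`-word `w'`
representing the same element, this applies to `c = w' - w`, formed level by level, and to the tails
`y p = T ^ (-p) ∑_{i > p} T ^ i (c i)`, which lie in `L` because `T L ⊆ L`. Hence at distance
`O (log (‖w‖_m + 1))` from the exponents of `w` all these tails lie in a fixed finite set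
(`exists_finset_tailEval_mem`).

It remains to see that `w'` cannot extend much beyond that distance, which is a pumping argument
(`le_of_mem_support_of_tailEval_mem`). If a word reaches far, some tail value occurs more than
`n + 1` times; it is nonzero as `w'` is minimal, and between two occurrences there is a letter since
`T` has no nonzero periodic points. Excising the stretch between the extreme occurrences gives a
word for the same element that is shorter by more than `n`. For the exponents below those of `w`,
the same argument is applied to `T⁻¹` and the reversed word.
-/

namespace TLog

open Filter Topology Polynomial
open scoped TensorProduct

/-! ### Integer polynomials with a dominant coefficient -/

/-- After normalization, `∏ (X - z ^ n)` tends coefficientwise to a monomial `X ^ k` as `n → ∞`,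
where `k` is the number of factors with `‖z‖ < 1`; the normalization `d n` is the product of the
`-z ^ n` over the other factors. -/
theorem coeff_prod_X_sub_C_pow_tendsto (s : Multiset ℂ) (hs : ∀ z ∈ s, ‖z‖ ≠ 1)  :
    ∃ (k : ℕ) (d : ℕ → ℂ), (∀ n, d n ≠ 0) ∧ ∀ i, Tendsto
      (fun n : ℕ => ((s.map fun z => X - C (z ^ n)).prod.coeff i) / d n) atTop
        (𝓝 (if i = k then 1 else 0)) := by
  induction s using Multiset.induction with
  | empty =>
    refine ⟨0, fun _ => 1, fun _ => one_ne_zero, fun i => ?_⟩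
    simp [coeff_one]
  | cons z s ih =>
    obtain ⟨k, d, hd, h⟩ := ih fun y hy => hs y (Multiset.mem_cons_of_mem hy)
    have hz := hs z (Multiset.mem_cons_self z s)
    -- the coefficients of the smaller product, multiplied by `X`
    have hX : ∀ i, Tendsto
        (fun n : ℕ => ((X * (s.map fun z => X - C (z ^ n)).prod).coeff i) / d n) atTop
          (𝓝 (if i = k + 1 then 1 else 0)) := by
      intro i
      rcases i with _ | i
      · simp
      · simpa using h i
    rcases lt_or_gt_of_ne hz with hz | hz
    · refine ⟨k + 1, d, hd, fun i => ?_⟩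
      have hz0 : Tendsto (fun n : ℕ => z ^ n) atTop (𝓝 0) :=
        tendsto_pow_atTop_nhds_zero_of_norm_lt_one hz
      have := (hX i).sub (hz0.mul (h i))
      rw [zero_mul, sub_zero] at this
      refine this.congr fun n => ?_
      rw [Multiset.map_cons, Multiset.prod_cons, sub_mul, coeff_sub, coeff_C_mul]
      ring
    · have hz0 : z ≠ 0 := by rintro rfl; simp at hz; linarith
      refine ⟨k, fun n => -z ^ n * d n,
        fun n => mul_ne_zero (neg_ne_zero.2 (pow_ne_zero n hz0)) (hd n), fun i => ?_⟩
      have hz1 : Tendsto (fun n : ℕ => z⁻¹ ^ n) atTop (𝓝 0) :=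
        tendsto_pow_atTop_nhds_zero_of_norm_lt_one (by
          rw [norm_inv]
          exact inv_lt_one_of_one_lt₀ hz)
      have := (h i).sub (hz1.mul (hX i))
      rw [zero_mul, sub_zero] at this
      refine this.congr fun n => ?_
      rw [Multiset.map_cons, Multiset.prod_cons, sub_mul, coeff_sub, coeff_C_mul]
      have := hd n
      have := pow_ne_zero n hz0
      rw [inv_pow]
      field_simp
      ring

/-- For large `n`, one coefficient of `∏ (X - z ^ n)` is larger than all the others together. -/
theorem exists_dominant_coeff_prod_X_sub_C_pow (s : Multiset ℂ) (hs : ∀ z ∈ s, ‖z‖ ≠ 1) :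
    ∃ k, ∀ᶠ n in atTop, ∀ t : Finset ℕ, t ⊆ Finset.range (s.card + 1) → k ∉ t →
      ∑ i ∈ t, ‖(s.map fun z => X - C (z ^ n)).prod.coeff i‖ <
        ‖(s.map fun z => X - C (z ^ n)).prod.coeff k‖ := by
  obtain ⟨k, d, hd, h⟩ := coeff_prod_X_sub_C_pow_tendsto s hs
  refine ⟨k, ?_⟩
  set c : ℕ → ℕ → ℂ := fun n i => (s.map fun z => X - C (z ^ n)).prod.coeff i with hc
  have h1 : Tendsto (fun n => ‖c n k / d n‖) atTop (𝓝 1) := by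
    simpa only [if_true, norm_one] using (h k).norm
  have h0 : Tendsto (fun n => ∑ i ∈ (Finset.range (s.card + 1)).erase k, ‖c n i / d n‖)
      atTop (𝓝 0) := by
    rw [← Finset.sum_const_zero (s := (Finset.range (s.card + 1)).erase k)]
    refine tendsto_finsetSum _ fun i hi => ?_
    simpa only [if_neg (Finset.ne_of_mem_erase hi), norm_zero] using (h i).norm
  filter_upwards [h0.eventually_lt h1 zero_lt_one] with n hn t ht hk
  simp only [norm_div, ← Finset.sum_div] at hn
  have hdn := norm_pos_iff.2 (hd n)
  rw [div_lt_div_iff_of_pos_right hdn] at hn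
  refine lt_of_le_of_lt (Finset.sum_le_sum_of_subset_of_nonneg (fun i hi => ?_)
    fun _ _ _ => norm_nonneg _) hn
  exact Finset.mem_erase.2 ⟨fun h => hk (h ▸ hi), ht hi⟩

/-- Graeffe's root squaring: `± p(X) p(-X)` is a polynomial in `X ^ 2` whose roots are the squares
of the roots of `p`. -/
theorem exists_map_eq_prod_sq (p : ℤ[X]) (s : Multiset ℂ)
    (hp : p.map (Int.castRingHom ℂ) = (s.map fun z => X - C z).prod) :
    ∃ q : ℤ[X], q.map (Int.castRingHom ℂ) = (s.map fun z => X - C (z ^ 2)).prod ∧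
      p ∣ expand ℤ 2 q := by
  set r : ℤ[X] := C ((-1) ^ s.card) * (p * p.comp (-X)) with hr
  have hmap : r.map (Int.castRingHom ℂ) = expand ℂ 2 (s.map fun z => X - C (z ^ 2)).prod := by
    have h1 : (p.comp (-X)).map (Int.castRingHom ℂ) = (s.map fun z => - X - C z).prod := by
      rw [Polynomial.map_comp, hp, multiset_prod_comp]
      simp [Multiset.map_map]
    have h2 : expand ℂ 2 (s.map fun z => X - C (z ^ 2)).prod =
        (s.map fun z => -1 * ((X - C z) * (-X - C z))).prod := by
      rw [map_multiset_prod, Multiset.map_map]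
      refine congrArg _ (Multiset.map_congr rfl fun z _ => ?_)
      rw [Function.comp_apply, map_sub, expand_X, expand_C, C_pow]
      ring
    rw [hr, Polynomial.map_mul, Polynomial.map_mul, h1, hp, h2, Multiset.prod_map_mul,
      Multiset.prod_map_mul, Multiset.map_const', Multiset.prod_replicate]
    simp
  have hq : (contract 2 r).map (Int.castRingHom ℂ) = (s.map fun z => X - C (z ^ 2)).prod := by
    rw [map_contract two_ne_zero, hmap, contract_expand _ two_ne_zero]
  refine ⟨contract 2 r, hq, ?_⟩
  have : expand ℤ 2 (contract 2 r) = r :=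
    map_injective (Int.castRingHom ℂ) Int.cast_injective (by rw [map_expand, hq, hmap])
  rw [this]
  exact Dvd.intro _ (by rw [hr]; ring : p * (C ((-1) ^ s.card) * p.comp (-X)) = r)

theorem exists_map_eq_prod_two_pow (p : ℤ[X]) (s : Multiset ℂ)
    (hp : p.map (Int.castRingHom ℂ) = (s.map fun z => X - C z).prod) (k : ℕ) :
    ∃ q : ℤ[X], q.map (Int.castRingHom ℂ) = (s.map fun z => X - C (z ^ 2 ^ k)).prod ∧
      p ∣ expand ℤ (2 ^ k) q := by
  induction k with
  | zero => exact ⟨p, by simpa using hp, by simp⟩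
  | succ k ih =>
    obtain ⟨q, hq, hpq⟩ := ih
    obtain ⟨q', hq', hqq⟩ := exists_map_eq_prod_sq q (s.map (· ^ 2 ^ k))
      (by rw [hq, Multiset.map_map]; rfl)
    refine ⟨q', ?_, hpq.trans ?_⟩
    · rw [hq', Multiset.map_map]
      simp only [Function.comp_def, ← pow_mul, ← pow_succ]
    · rw [pow_succ, ← expand_expand]
      exact _root_.map_dvd (expand ℤ (2 ^ k)) hqq

theorem exists_dominant_multiple (p : ℤ[X]) (hp : p.Monic)
    (hroots : ∀ z : ℂ, (p.map (Int.castRingHom ℂ)).IsRoot z → ‖z‖ ≠ 1) :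
    ∃ (q : ℤ[X]) (j : ℕ), p ∣ q ∧ ∑ i ∈ q.support.erase j, |q.coeff i| < |q.coeff j| := by
  set P := p.map (Int.castRingHom ℂ) with hP
  have hPm : P.Monic := hp.map _
  have hprod : P = (P.roots.map fun z => X - C z).prod :=
    ((IsAlgClosed.splits P).eq_prod_roots_of_monic hPm)
  obtain ⟨k, hk⟩ := exists_dominant_coeff_prod_X_sub_C_pow P.roots
    fun z hz => hroots z (isRoot_of_mem_roots hz)
  obtain ⟨n, hn⟩ := ((tendsto_pow_atTop_atTop_of_one_lt (one_lt_two (α := ℕ))).eventually hk).exists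
  obtain ⟨q, hq, hpq⟩ := exists_map_eq_prod_two_pow p P.roots hprod n
  have h2 : 0 < 2 ^ n := by positivity
  refine ⟨expand ℤ (2 ^ n) q, k * 2 ^ n, hpq, ?_⟩
  have hcoeff : ∀ i, ‖(P.roots.map fun z => X - C (z ^ 2 ^ n)).prod.coeff i‖ = |q.coeff i| := by
    intro i
    rw [← hq, coeff_map, eq_intCast, Complex.norm_intCast, Int.cast_abs]
  simp only [hcoeff] at hn
  have hdeg : q.natDegree ≤ P.roots.card := by
    rw [← natDegree_map_eq_of_injective (f := Int.castRingHom ℂ) Int.cast_injective, hq]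
    refine (natDegree_multiset_prod_le _).trans ?_
    rw [Multiset.map_map]
    refine (Multiset.sum_le_card_nsmul _ 1 fun m hm => ?_).trans (by simp)
    obtain ⟨z, _, rfl⟩ := Multiset.mem_map.1 hm
    exact (natDegree_X_sub_C _).le
  have key := hn (q.support.erase k) (fun i hi => by
    have := le_natDegree_of_mem_supp i (Finset.mem_of_mem_erase hi)
    simp; omega) (by simp)
  rw [coeff_expand_mul h2]
  have key' : ∑ i ∈ q.support.erase k, |q.coeff i| < |q.coeff k| := by exact_mod_cast key
  refine lt_of_le_of_lt ?_ key'
  have hinj : Function.Injective (· * 2 ^ n : ℕ → ℕ) := fun a b h => Nat.eq_of_mul_eq_mul_right h2 h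
  calc ∑ i ∈ (expand ℤ (2 ^ n) q).support.erase (k * 2 ^ n), |(expand ℤ (2 ^ n) q).coeff i|
      ≤ ∑ i ∈ (q.support.erase k).image (· * 2 ^ n), |(expand ℤ (2 ^ n) q).coeff i| := by
        refine Finset.sum_le_sum_of_subset_of_nonneg (fun i hi => ?_) fun _ _ _ => abs_nonneg _
        rw [Finset.mem_erase, mem_support_iff, coeff_expand h2] at hi
        obtain ⟨hik, hi⟩ := hi
        split_ifs at hi with hdvd
        · obtain ⟨m, rfl⟩ := hdvd
          rw [Nat.mul_div_cancel_left _ h2] at hi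
          refine Finset.mem_image.2 ⟨m, Finset.mem_erase.2 ⟨?_, mem_support_iff.2 hi⟩, mul_comm _ _⟩
          rintro rfl
          exact hik (mul_comm _ _)
        · exact absurd rfl hi
    _ = ∑ i ∈ q.support.erase k, |q.coeff i| := by
        rw [Finset.sum_image (fun a _ b _ h => hinj h)]
        simp only [coeff_expand_mul h2]

/-! ### A maximum principle for linear recurrences -/

section Recurrence

variable {G : Type*} [AddCommGroup G]

/-- Up to an error controlled by `c`, going back `i` steps in the recurrence is applying `M ^ i`. -/
theorem exists_backward_orbit_bound (ν : AddGroupSeminorm G) (M : G →ₗ[ℤ] G) {C : ℝ} (hC : 0 ≤ C)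
    (hM : ∀ x, ν (M x) ≤ C * ν x) (i : ℕ) :
    ∃ Ci : ℝ, 0 ≤ Ci ∧ ∀ (y c : ℤ → G) (R : ℝ) (p : ℤ), (∀ p, y p = M (y (p + 1) + c (p + 1))) →
      (∀ l : ℕ, l < i → ν (c (p - l)) ≤ R) → ν (y (p - i) - (M ^ i) (y p)) ≤ Ci * R := by
  induction i with
  | zero => exact ⟨0, le_rfl, fun y c R p _ _ => by simp⟩
  | succ i ih =>
    obtain ⟨Ci, hCi, h⟩ := ih
    refine ⟨C * (Ci + 1), by positivity, fun y c R p hy hc => ?_⟩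
    have h1 := h y c R p hy fun l hl => hc l (hl.trans i.lt_succ_self)
    have h2 := hc i i.lt_succ_self
    have h3 : y (p - (i + 1 : ℕ)) - (M ^ (i + 1)) (y p) =
        M ((y (p - i) - (M ^ i) (y p)) + c (p - i)) := by
      rw [hy (p - (i + 1 : ℕ)), pow_succ', Module.End.mul_apply, ← map_sub]
      have : p - ((i + 1 : ℕ) : ℤ) + 1 = p - i := by push_cast; ring
      rw [this]
      congr 1
      abel
    rw [h3]
    calc ν (M ((y (p - i) - (M ^ i) (y p)) + c (p - i)))
        ≤ C * ν ((y (p - i) - (M ^ i) (y p)) + c (p - i)) := hM _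
      _ ≤ C * (Ci * R + R) := by gcongr; exact (map_add_le_add ν _ _).trans (add_le_add h1 h2)
      _ = C * (Ci + 1) * R := by ring

/-- One step of the maximum principle: at `p`, a solution is at most a factor `θ < 1` of its
supremum near `p`, up to the size of the inhomogeneity near `p`. -/
theorem exists_dominated_recurrence (ν : AddGroupSeminorm G)
    (hν : ∀ (n : ℤ) x, ν (n • x) = |n| * ν x) (M : G →ₗ[ℤ] G) {C : ℝ} (hC : 0 ≤ C)
    (hM : ∀ x, ν (M x) ≤ C * ν x) (q : ℤ[X]) (hq : aeval M q = 0) (j : ℕ)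
    (hj : ∑ i ∈ q.support.erase j, |q.coeff i| < |q.coeff j|) :
    ∃ (θ C₁ : ℝ) (D : ℕ), 0 ≤ θ ∧ θ < 1 ∧ 0 ≤ C₁ ∧ ∀ (y c : ℤ → G) (R S : ℝ) (p : ℤ),
      (∀ p, y p = M (y (p + 1) + c (p + 1))) →
      (∀ i, |i - p| ≤ D → ν (c i) ≤ R) → (∀ i, |i - p| ≤ D → ν (y i) ≤ S) →
      ν (y p) ≤ θ * S + C₁ * R := by
  choose K hK0 hK using exists_backward_orbit_bound ν M hC hM
  have hqj : (0 : ℝ) < |q.coeff j| := by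
    exact_mod_cast (Finset.sum_nonneg fun _ _ => abs_nonneg _).trans_lt hj
  have hjs : j ∈ q.support := by
    rw [mem_support_iff]
    rintro h
    simp [h] at hqj
  refine ⟨(∑ i ∈ q.support.erase j, (|q.coeff i| : ℝ)) / |q.coeff j|,
    (∑ i ∈ q.support, |q.coeff i| * K i) / |q.coeff j|, q.natDegree, by positivity, ?_,
    div_nonneg (Finset.sum_nonneg fun i _ => mul_nonneg (by positivity) (hK0 i)) hqj.le, ?_⟩
  · rw [div_lt_one hqj]
    exact_mod_cast hj
  intro y c R S p hy hc hS
  set P : ℤ := p + j with hP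
  have hjd : j ≤ q.natDegree := le_natDegree_of_mem_supp j hjs
  have hrel : ∑ i ∈ q.support, q.coeff i • (M ^ i) (y P) = 0 := by
    have := LinearMap.congr_fun hq (y P)
    rw [aeval_def, eval₂_eq_sum, sum_def] at this
    simpa [Module.algebraMap_end_apply] using this
  have hsplit : q.coeff j • y p = ∑ i ∈ q.support, q.coeff i • (y (P - i) - (M ^ i) (y P)) -
      ∑ i ∈ q.support.erase j, q.coeff i • y (P - i) := by
    simp only [smul_sub, Finset.sum_sub_distrib, hrel, sub_zero]
    rw [← Finset.add_sum_erase _ _ hjs, add_sub_cancel_right, hP, add_sub_cancel_right]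
  have hsum : ∀ (s : Finset ℕ) (f : ℕ → G), ν (∑ i ∈ s, f i) ≤ ∑ i ∈ s, ν (f i) := fun s f =>
    Finset.le_sum_of_subadditive ν (map_zero ν).le (map_add_le_add ν) s f
  have hmain : |q.coeff j| * ν (y p) ≤ (∑ i ∈ q.support, |q.coeff i| * K i) * R +
      (∑ i ∈ q.support.erase j, (|q.coeff i| : ℝ)) * S := by
    rw [← hν, hsplit]
    refine (map_sub_le_add ν _ _).trans (add_le_add ?_ ?_)
    · refine (hsum _ _).trans ?_
      rw [Finset.sum_mul]
      refine Finset.sum_le_sum fun i hi => ?_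
      rw [hν, mul_assoc]
      refine mul_le_mul_of_nonneg_left (hK i y c R P hy fun l hl => hc _ ?_) (by positivity)
      have := le_natDegree_of_mem_supp i hi
      rw [hP, abs_le]
      constructor <;> omega
    · refine (hsum _ _).trans ?_
      rw [Finset.sum_mul]
      refine Finset.sum_le_sum fun i hi => ?_
      rw [hν, Int.cast_abs]
      refine mul_le_mul_of_nonneg_left (hS _ ?_) (by positivity)
      have := le_natDegree_of_mem_supp i (Finset.mem_of_mem_erase hi)
      rw [hP, abs_le]
      constructor <;> omega
  rw [div_mul_eq_mul_div, div_mul_eq_mul_div, ← add_div, le_div_iff₀ hqj]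
  linarith

/-- The maximum principle iterated `r` times. -/
theorem exists_recurrence_decay (ν : AddGroupSeminorm G)
    (hν : ∀ (n : ℤ) x, ν (n • x) = |n| * ν x) (M : G →ₗ[ℤ] G) {C : ℝ} (hC : 0 ≤ C)
    (hM : ∀ x, ν (M x) ≤ C * ν x) (q : ℤ[X]) (hq : aeval M q = 0) (j : ℕ)
    (hj : ∑ i ∈ q.support.erase j, |q.coeff i| < |q.coeff j|) :
    ∃ (θ C₁ : ℝ) (D : ℕ), 0 ≤ θ ∧ θ < 1 ∧ 0 ≤ C₁ ∧ ∀ (y c : ℤ → G),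
      (∀ p, y p = M (y (p + 1) + c (p + 1))) → ∀ S : ℝ, (∀ i, ν (y i) ≤ S) →
      ∀ (R : ℝ) (r : ℕ) (p : ℤ), (∀ i, |i - p| ≤ D * r → ν (c i) ≤ R) →
        ν (y p) ≤ θ ^ r * S + C₁ * R := by
  obtain ⟨θ, C₁, D, hθ, hθ1, hC₁, h⟩ := exists_dominated_recurrence ν hν M hC hM q hq j hj
  have hθ' : 0 < 1 - θ := by linarith
  refine ⟨θ, C₁ / (1 - θ), D, hθ, hθ1, by positivity, fun y c hy S hS R r => ?_⟩
  induction r with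
  | zero =>
    intro p hc
    have : 0 ≤ R := (apply_nonneg ν _).trans (hc p (by simp))
    have : 0 ≤ C₁ / (1 - θ) * R := by positivity
    have := hS p
    rw [pow_zero, one_mul]
    linarith
  | succ r ih =>
    intro p hc
    have hstep := h y c R (θ ^ r * S + C₁ / (1 - θ) * R) p hy
      (fun i hi => hc i (hi.trans (by
        push_cast
        nlinarith [Int.natCast_nonneg D, Int.natCast_nonneg r])))
      (fun i hi => ih i fun k hk => hc k (by
        have := abs_sub_le k i p
        push_cast
        linarith))
    refine hstep.trans (le_of_eq ?_)
    field_simp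
    ring

/-- A bounded solution of the recurrence is bounded by its inhomogeneity `c`, and where `c` is at
most `R₀` on a long interval, the influence of the global bound `R` decays exponentially. -/
theorem exists_recurrence_bound (ν : AddGroupSeminorm G)
    (hν : ∀ (n : ℤ) x, ν (n • x) = |n| * ν x) (M : G →ₗ[ℤ] G) {C : ℝ} (hC : 0 ≤ C)
    (hM : ∀ x, ν (M x) ≤ C * ν x) (q : ℤ[X]) (hq : aeval M q = 0) (j : ℕ)
    (hj : ∑ i ∈ q.support.erase j, |q.coeff i| < |q.coeff j|) :
    ∃ (θ C₁ : ℝ) (D : ℕ), 0 ≤ θ ∧ θ < 1 ∧ 0 ≤ C₁ ∧ ∀ (y c : ℤ → G),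
      (∀ p, y p = M (y (p + 1) + c (p + 1))) → (∃ S : ℝ, ∀ i, ν (y i) ≤ S) →
      ∀ R : ℝ, (∀ i, ν (c i) ≤ R) → (∀ p, ν (y p) ≤ C₁ * R) ∧
      ∀ (R₀ : ℝ) (r : ℕ) (p : ℤ), (∀ i, |i - p| ≤ D * r → ν (c i) ≤ R₀) →
        ν (y p) ≤ θ ^ r * (C₁ * R) + C₁ * R₀ := by
  obtain ⟨θ, C₁, D, hθ, hθ1, hC₁, h⟩ := exists_recurrence_decay ν hν M hC hM q hq j hj
  refine ⟨θ, C₁, D, hθ, hθ1, hC₁, fun y c hy ⟨S, hS⟩ R hR => ?_⟩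
  have hbd : ∀ p, ν (y p) ≤ C₁ * R := fun p => by
    have hlim : Tendsto (fun r : ℕ => θ ^ r * S + C₁ * R) atTop (𝓝 (0 * S + C₁ * R)) :=
      ((tendsto_pow_atTop_nhds_zero_of_lt_one hθ hθ1).mul_const S).add_const _
    rw [zero_mul, zero_add] at hlim
    exact ge_of_tendsto' hlim fun r => h y c hy S hS R r p fun i _ => hR i
  exact ⟨hbd, h y c hy _ hbd⟩

end Recurrence

/-! ### Minimal words in a free abelian group and the coefficient box -/

section FreeWords

variable {K : Type*} [AddCommGroup K]

theorem freeEval_eq_linearCombination {B : Set K} (w : B →₀ ℤ) :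
    freeEval w = Finsupp.linearCombination ℤ ((↑) : B → K) w := by
  rw [freeEval, Finsupp.linearCombination_apply]

theorem wordLength_add_le {X : Type*} (f g : X →₀ ℤ) :
    wordLength (f + g) ≤ wordLength f + wordLength g := by
  classical
  have h : ∀ k : X →₀ ℤ, k.support ⊆ f.support ∪ g.support →
      wordLength k = ∑ x ∈ f.support ∪ g.support, (k x).natAbs := fun k hk =>
    Finsupp.sum_of_support_subset _ hk _ (by simp)
  rw [h f Finset.subset_union_left, h g Finset.subset_union_right, h _ Finsupp.support_add,
    ← Finset.sum_add_distrib]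
  exact Finset.sum_le_sum fun x _ => Int.natAbs_add_le _ _

theorem wordLength_sum_le {X ι : Type*} (s : Finset ι) (f : ι → X →₀ ℤ) :
    wordLength (∑ i ∈ s, f i) ≤ ∑ i ∈ s, wordLength (f i) :=
  Finset.le_sum_of_subadditive wordLength (by simp [wordLength]) wordLength_add_le s f

theorem wordLength_single {X : Type*} (x : X) (n : ℤ) :
    wordLength (Finsupp.single x n) = n.natAbs :=
  Finsupp.sum_single_index (by simp)

theorem wordLength_eq_erase_add {X : Type*} (f : X →₀ ℤ) (x : X) :
    wordLength f = wordLength (f.erase x) + (f x).natAbs := by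
  classical
  by_cases hx : x ∈ f.support
  · rw [wordLength, wordLength, ← Finsupp.add_sum_erase f x _ hx, add_comm]
  · rw [Finsupp.erase_of_notMem_support hx, Finsupp.notMem_support_iff.1 hx]
    simp

theorem apply_zpow_mem_translates (T : K ≃ₗ[ℤ] K) {A : Set K} {b : K} (hb : b ∈ translates T A)
    (i : ℤ) : (T ^ i) b ∈ translates T A := by
  obtain ⟨k, a, ha, rfl⟩ := Set.mem_iUnion.1 hb
  exact Set.mem_iUnion.2 ⟨i + k, a, ha, by rw [zpow_add, LinearEquiv.mul_apply]⟩

/-- Subtracting a multiple of the relation `q(T) T ^ (-j) b = 0` shortens every word whose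
coefficient at `b` is at least `|q.coeff j|` in absolute value. -/
theorem boundsCoefficients_of_dominant (T : K ≃ₗ[ℤ] K) (q : ℤ[X])
    (hq : ∀ k : K, ∑ i ∈ q.support, q.coeff i • (T ^ (i : ℤ)) k = 0) (j : ℕ)
    (hj : ∑ i ∈ q.support.erase j, |q.coeff i| < |q.coeff j|) (A : Set K) :
    BoundsCoefficients T A (q.coeff j).natAbs := by
  classical
  intro w hw b
  by_contra! hlt
  have hj0 : q.coeff j ≠ 0 := by
    rw [← abs_pos]
    exact (Finset.sum_nonneg fun _ _ => abs_nonneg _).trans_lt hj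
  have hjs : j ∈ q.support := mem_support_iff.2 hj0
  set bb : ℕ → translates T A := fun i => ⟨(T ^ ((i : ℤ) - j)) b, apply_zpow_mem_translates T b.2 _⟩
    with hbb
  have hbj : bb j = b := by simp [hbb]
  -- the sign that makes the coefficient at `b` smaller
  obtain ⟨s, hs, hsb⟩ : ∃ s : ℤ, s.natAbs = 1 ∧
      (w b + s * q.coeff j).natAbs + (q.coeff j).natAbs = (w b).natAbs := by
    have hlt' : (q.coeff j).natAbs ≤ (w b).natAbs := by
      rw [Int.abs_eq_natAbs] at hlt
      exact_mod_cast hlt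
    rcases le_total 0 (w b) with h1 | h1 <;> rcases le_total 0 (q.coeff j) with h2 | h2
    · exact ⟨-1, rfl, by omega⟩
    · exact ⟨1, rfl, by omega⟩
    · exact ⟨1, rfl, by omega⟩
    · exact ⟨-1, rfl, by omega⟩
  set rest : translates T A →₀ ℤ := ∑ i ∈ q.support.erase j, Finsupp.single (bb i) (s * q.coeff i)
    with hrest
  set v : translates T A →₀ ℤ := w.erase b + Finsupp.single b (w b + s * q.coeff j) + rest with hv
  have hv' : v = w + ∑ i ∈ q.support, Finsupp.single (bb i) (s * q.coeff i) := by
    rw [← Finset.add_sum_erase _ _ hjs, hbj, hv, Finsupp.single_add, ← add_assoc, ← add_assoc,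
      Finsupp.erase_add_single]
  have heval : freeEval v = freeEval w := by
    rw [freeEval_eq_linearCombination, freeEval_eq_linearCombination, hv', map_add, map_sum,
      add_eq_left]
    have := congrArg (s • ·) (hq ((T ^ (-(j : ℤ))) b))
    simp only [smul_zero, Finset.smul_sum, smul_smul] at this
    rw [← this]
    refine Finset.sum_congr rfl fun i _ => ?_
    rw [Finsupp.linearCombination_single]
    rw [show (bb i : K) = (T ^ ((i : ℤ) - j)) b from rfl, sub_eq_add_neg, zpow_add,
      LinearEquiv.mul_apply]
  have hlen := hw v heval
  have h1 : wordLength v ≤ wordLength (w.erase b) + (w b + s * q.coeff j).natAbs +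
      ∑ i ∈ q.support.erase j, (q.coeff i).natAbs := by
    refine (wordLength_add_le _ _).trans (add_le_add ((wordLength_add_le _ _).trans ?_) ?_)
    · rw [wordLength_single]
    · refine (wordLength_sum_le _ _).trans (Finset.sum_le_sum fun i _ => ?_)
      rw [wordLength_single, Int.natAbs_mul, hs, one_mul]
  have h2 : ∑ i ∈ q.support.erase j, (q.coeff i).natAbs < (q.coeff j).natAbs := by
    zify
    exact hj
  have h3 := wordLength_eq_erase_add w b
  omega

end FreeWords

section Box

variable {K : Type*} [AddCommGroup K]

theorem finite_coefficientBox (A : Finset K) (N : ℕ) : (coefficientBox A N).Finite := by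
  classical
  refine (Set.finite_range fun c : A → Set.Ioo (-(N : ℤ)) N =>
    ∑ a : A, (c a : ℤ) • (a : K)).subset ?_
  rintro k ⟨c, hc, rfl⟩
  refine ⟨fun a => ⟨c a, abs_lt.1 (hc a a.2)⟩, ?_⟩
  exact Finset.sum_coe_sort A fun a => c a • a

theorem neg_mem_coefficientBox {A : Finset K} {N : ℕ} {k : K} (hk : k ∈ coefficientBox A N) :
    -k ∈ coefficientBox A N := by
  obtain ⟨c, hc, rfl⟩ := hk
  exact ⟨fun a => -c a, fun a ha => by simpa using hc a ha, by simp⟩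

theorem BoundsCoefficients.pos {T : K ≃ₗ[ℤ] K} {A : Set K} {N : ℕ} (hN : BoundsCoefficients T A N)
    {a : K} (ha : a ∈ A) : 0 < N := by
  have := hN 0 (fun v _ => by simp [wordLength])
    ⟨a, Set.mem_iUnion.2 ⟨0, a, ha, by simp⟩⟩
  simpa using this

theorem zero_mem_coefficientBox {T : K ≃ₗ[ℤ] K} {A : Finset K} {N : ℕ}
    (hN : BoundsCoefficients T (A : Set K) N) : (0 : K) ∈ coefficientBox A N :=
  ⟨fun _ => 0, fun _ ha => by simpa using hN.pos ha, by simp⟩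

theorem exists_freeEval_eq {T : K ≃ₗ[ℤ] K} {A : Set K}
    (hA : (⋃ i : ℤ, (T ^ i) '' (AddSubgroup.closure A : Set K)) = Set.univ) (k : K) :
    ∃ w : translates T A →₀ ℤ, freeEval w = k := by
  obtain ⟨i, l, hl, rfl⟩ := Set.mem_iUnion.1 (hA.symm ▸ Set.mem_univ k)
  induction hl using AddSubgroup.closure_induction with
  | mem a ha =>
    refine ⟨Finsupp.single ⟨(T ^ i) a, Set.mem_iUnion.2 ⟨i, a, ha, rfl⟩⟩ 1, ?_⟩
    rw [freeEval_eq_linearCombination, Finsupp.linearCombination_single, one_smul]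
  | zero => exact ⟨0, by simp [freeEval]⟩
  | add x y _ _ hx hy =>
    obtain ⟨v, hv⟩ := hx
    obtain ⟨w, hw⟩ := hy
    rw [freeEval_eq_linearCombination] at hv hw
    exact ⟨v + w, by rw [freeEval_eq_linearCombination, map_add, hv, hw, map_add]⟩
  | neg x _ hx =>
    obtain ⟨v, hv⟩ := hx
    rw [freeEval_eq_linearCombination] at hv
    exact ⟨-v, by rw [freeEval_eq_linearCombination, map_neg, hv, map_neg]⟩

theorem exists_minimal_freeEval_eq {T : K ≃ₗ[ℤ] K} {A : Set K}
    (hA : (⋃ i : ℤ, (T ^ i) '' (AddSubgroup.closure A : Set K)) = Set.univ) (k : K) :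
    ∃ w : translates T A →₀ ℤ, freeEval w = k ∧
      ∀ v : translates T A →₀ ℤ, freeEval v = freeEval w → wordLength w ≤ wordLength v := by
  have hne : {w : translates T A →₀ ℤ | freeEval w = k}.Nonempty := exists_freeEval_eq hA k
  refine ⟨Function.argminOn wordLength _ hne, Function.argminOn_mem wordLength _ hne,
    fun v hv => Function.argminOn_le wordLength _ ?_⟩
  exact hv.trans (Function.argminOn_mem wordLength _ hne)

theorem tEval_single (T : K ≃ₗ[ℤ] K) (i : ℤ) (k : K) : tEval T (Finsupp.single i k) = (T ^ i) k :=
  Finsupp.sum_single_index (map_zero _)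

theorem tEval_add (T : K ≃ₗ[ℤ] K) (u v : ℤ →₀ K) : tEval T (u + v) = tEval T u + tEval T v :=
  Finsupp.sum_add_index' (fun _ => map_zero _) fun _ => map_add _

theorem tEval_sum (T : K ≃ₗ[ℤ] K) {ι : Type*} (s : Finset ι) (f : ι → ℤ →₀ K) :
    tEval T (∑ i ∈ s, f i) = ∑ i ∈ s, tEval T (f i) :=
  map_sum (⟨⟨tEval T, Finsupp.sum_zero_index⟩, tEval_add T⟩ : (ℤ →₀ K) →+ K) f s

/-- A word of minimal length in `ℤ^B`, sorted by levels, is a `t`-word in the coefficient box. -/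
theorem isTGenerating_coefficientBox {T : K ≃ₗ[ℤ] K} {A : Finset K}
    (hA : (⋃ i : ℤ, (T ^ i) '' (AddSubgroup.closure (A : Set K) : Set K)) = Set.univ) {N : ℕ}
    (hN : BoundsCoefficients T (A : Set K) N) : IsTGenerating T (coefficientBox A N) := by
  classical
  refine Set.eq_univ_of_forall fun k => ?_
  obtain ⟨w, rfl, hw⟩ := exists_minimal_freeEval_eq hA k
  -- a level `i` and a letter `a ∈ A` with `b = T ^ i a`, for every `b ∈ ⋃ i, T ^ i A`
  have hch : ∀ b : translates T (A : Set K), ∃ (i : ℤ) (a : K), a ∈ A ∧ (T ^ i) a = b := fun b => by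
    obtain ⟨i, a, ha, h⟩ := Set.mem_iUnion.1 b.2
    exact ⟨i, a, ha, h⟩
  choose lev letter hmem hval using hch
  refine ⟨∑ b ∈ w.support, Finsupp.single (lev b) (w b • letter b), fun i => ?_, ?_⟩
  · have hi : ∀ a ∈ A, (T ^ i) a ∈ translates T (A : Set K) := fun a ha =>
      Set.mem_iUnion.2 ⟨i, a, ha, rfl⟩
    refine ⟨fun a => if h : (T ^ i) a ∈ translates T (A : Set K) then
      if lev ⟨_, h⟩ = i then w ⟨_, h⟩ else 0 else 0, fun a ha => ?_, ?_⟩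
    · dsimp only
      split_ifs
      · exact hN w hw _
      · simpa using hN.pos ha
      · simpa using hN.pos ha
    · rw [Finsupp.finsetSum_apply]
      simp only [Finsupp.single_apply]
      rw [← Finset.sum_filter]
      refine Finset.sum_of_injOn letter (fun b hb b' hb' h => ?_) (fun b _ => hmem b)
        (fun a ha hna => ?_) (fun b hb => ?_)
      · have h1 := (Finset.mem_filter.1 hb).2
        have h2 := (Finset.mem_filter.1 hb').2
        exact Subtype.ext (by rw [← hval, ← hval, h1, h2, h])
      · rw [dif_pos (hi a ha)]
        split_ifs with hl
        · by_contra hne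
          refine hna ⟨⟨_, hi a ha⟩, ?_, ?_⟩
          · refine Finset.mem_coe.2 (Finset.mem_filter.2 ⟨Finsupp.mem_support_iff.2 ?_, hl⟩)
            rintro h0
            exact hne (by rw [h0, zero_smul])
          · have := hval ⟨_, hi a ha⟩
            rw [hl] at this
            exact (T ^ i).injective this
        · simp
      · have h1 := (Finset.mem_filter.1 hb).2
        have h2 : (T ^ i) (letter b) = b := by rw [← h1, hval]
        have h3 : (⟨(T ^ i) (letter b), hi _ (hmem b)⟩ : translates T (A : Set K)) = b :=
          Subtype.ext h2
        rw [dif_pos (hi _ (hmem b)), h3, if_pos h1]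
  · rw [tEval_sum, freeEval, Finsupp.sum]
    refine Finset.sum_congr rfl fun b _ => ?_
    rw [tEval_single, map_zsmul, hval]

end Box

/-! ### Tails of words and the pumping argument -/

section Tails

variable {K : Type*} [AddCommGroup K]

theorem tEval_sub (T : K ≃ₗ[ℤ] K) (u v : ℤ →₀ K) : tEval T (u - v) = tEval T u - tEval T v :=
  Finsupp.sum_sub_index fun _ => map_sub _

/-- The part of the `t`-word `v` beyond the exponent `p`, shifted back by `p` and evaluated. -/
noncomputable def tailEval (T : K ≃ₗ[ℤ] K) (p : ℤ) (v : ℤ →₀ K) : K :=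
  (T ^ (-p)) (tEval T (v.filter (p < ·)))

theorem tEval_filter_lt (T : K ≃ₗ[ℤ] K) (p : ℤ) (v : ℤ →₀ K) :
    tEval T (v.filter (p < ·)) = (T ^ p) (tailEval T p v) := by
  rw [tailEval, ← LinearEquiv.mul_apply, ← zpow_add, add_neg_cancel, zpow_zero]
  rfl

theorem tEval_filter_not_lt (T : K ≃ₗ[ℤ] K) (p : ℤ) (v : ℤ →₀ K) :
    tEval T (v.filter fun i => ¬ p < i) + (T ^ p) (tailEval T p v) = tEval T v := by
  rw [← tEval_filter_lt, ← tEval_add, add_comm, Finsupp.filter_add_filter_not]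

theorem tailEval_sub (T : K ≃ₗ[ℤ] K) (p : ℤ) (u v : ℤ →₀ K) :
    tailEval T p (u - v) = tailEval T p u - tailEval T p v := by
  rw [tailEval, Finsupp.filter_sub, tEval_sub, map_sub]
  rfl

theorem tailEval_eq_zero (T : K ≃ₗ[ℤ] K) {p : ℤ} {v : ℤ →₀ K} (h : ∀ i ∈ v.support, i ≤ p) :
    tailEval T p v = 0 := by
  have : v.filter (p < ·) = 0 := by
    rw [Finsupp.filter_eq_zero_iff]
    intro i hi
    by_contra hne
    exact (h i (Finsupp.mem_support_iff.2 hne)).not_gt hi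
  rw [tailEval, this, tEval, Finsupp.sum_zero_index, map_zero]

theorem tailEval_eq_tEval (T : K ≃ₗ[ℤ] K) {p : ℤ} {v : ℤ →₀ K} (h : ∀ i ∈ v.support, p < i) :
    tailEval T p v = (T ^ (-p)) (tEval T v) := by
  rw [tailEval, (Finsupp.filter_eq_self_iff _ _).2 fun i hi => h i (Finsupp.mem_support_iff.2 hi)]

theorem tailEval_eq_apply (T : K ≃ₗ[ℤ] K) (p : ℤ) (v : ℤ →₀ K) :
    tailEval T p v = T (tailEval T (p + 1) v + v (p + 1)) := by
  have h : v.filter (p < ·) = v.filter (p + 1 < ·) + Finsupp.single (p + 1) (v (p + 1)) := by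
    ext i
    simp only [Finsupp.filter_apply, Finsupp.add_apply, Finsupp.single_apply]
    rcases lt_trichotomy i (p + 1) with h | rfl | h
    · rw [if_neg (by omega), if_neg (by omega), if_neg (by omega), add_zero]
    · rw [if_pos (by omega), if_neg (by omega), if_pos rfl, zero_add]
    · rw [if_pos (by omega), if_pos h, if_neg (by omega), add_zero]
  have hT : ∀ x, T x = (T ^ (1 : ℤ)) x := fun x => by rw [zpow_one]
  rw [tailEval, h, tEval_add, tEval_single, tEval_filter_lt, hT, ← map_add, ← LinearEquiv.mul_apply,
    ← zpow_add]
  congr 2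
  ring

theorem tailEval_mem (T : K ≃ₗ[ℤ] K) {L : AddSubgroup K} (hTL : ∀ x ∈ L, T x ∈ L) {v : ℤ →₀ K}
    (hv : ∀ i, v i ∈ L) (p : ℤ) : tailEval T p v ∈ L := by
  have hpow : ∀ (n : ℕ) (x : K), x ∈ L → (T ^ n) x ∈ L := fun n => by
    induction n with
    | zero => exact fun x hx => by simpa using hx
    | succ n ih => exact fun x hx => by rw [pow_succ, LinearEquiv.mul_apply]; exact ih _ (hTL x hx)
  rw [tailEval, tEval, Finsupp.sum, map_sum]
  refine sum_mem fun i hi => ?_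
  rw [Finsupp.support_filter, Finset.mem_filter] at hi
  obtain ⟨n, hn⟩ := Int.eq_ofNat_of_zero_le (by omega : 0 ≤ -p + i)
  rw [← LinearEquiv.mul_apply, ← zpow_add, hn, Finsupp.filter_apply_pos _ _ hi.2, zpow_natCast]
  exact hpow n _ (hv i)

end Tails

section Pumping

variable {K : Type*} [AddCommGroup K]

/-- The `t`-word obtained from `v` by deleting the letters with exponent in `(p, q]` and closing
the gap. -/
noncomputable def excise (p q : ℤ) (v : ℤ →₀ K) : ℤ →₀ K :=
  (v.filter fun i => ¬ p < i) + (v.filter (q < ·)).equivMapDomain (Equiv.addRight (p - q))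

theorem excise_apply (p q : ℤ) (v : ℤ →₀ K) (i : ℤ) :
    excise p q v i = if i ≤ p then v i else v (i - (p - q)) := by
  simp only [excise, Finsupp.add_apply, Finsupp.filter_apply, Finsupp.equivMapDomain_apply,
    Equiv.addRight_symm, Equiv.coe_addRight, not_lt]
  by_cases h : i ≤ p
  · rw [if_pos h, if_pos h, if_neg (by omega), add_zero]
  · rw [if_neg h, if_neg h, if_pos (by omega), zero_add, sub_eq_add_neg i]

theorem tEval_excise (T : K ≃ₗ[ℤ] K) (p q : ℤ) (v : ℤ →₀ K) (h : tailEval T p v = tailEval T q v) :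
    tEval T (excise p q v) = tEval T v := by
  rw [← tEval_filter_not_lt T p v, h, excise, tEval_add, add_right_inj, tailEval, tEval, tEval,
    Finsupp.equivMapDomain_eq_mapDomain,
    Finsupp.sum_mapDomain_index (fun _ => map_zero _) (fun _ => map_add _), Finsupp.sum,
    Finsupp.sum, map_sum, map_sum]
  refine Finset.sum_congr rfl fun i _ => ?_
  rw [← LinearEquiv.mul_apply, ← LinearEquiv.mul_apply, ← zpow_add, ← zpow_add,
    Equiv.coe_addRight]
  congr 2
  ring

theorem tLength_excise_le (p q : ℤ) (v : ℤ →₀ K) :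
    tLength (excise p q v) ≤
      (v.support.filter fun i => ¬ p < i).card + (v.support.filter (q < ·)).card := by
  classical
  refine (Finset.card_le_card Finsupp.support_add).trans ((Finset.card_union_le _ _).trans ?_)
  simp [Finsupp.support_filter, Finsupp.equivMapDomain]

theorem isTWord_excise {A : Set K} {v : ℤ →₀ K} (hv : IsTWord A v) (p q : ℤ) :
    IsTWord A (excise p q v) := fun i => by
  rw [excise_apply]
  split_ifs <;> exact hv _

/-- The pumping argument: if all tails of `v` beyond `p₀` lie in the finite set `F`, and `v` is a
minimal word within `n` of the least possible length, then `v` ends soon after `p₀`. -/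
theorem le_of_mem_support_of_tailEval_mem {T : K ≃ₗ[ℤ] K}
    (hper : ∀ (k : ℤ) (y : K), 0 < k → (T ^ k) y = y → y = 0) {A : Set K} (h0 : (0 : K) ∈ A) {n : ℕ}
    {v : ℤ →₀ K} (hv : IsMinimalTWord T A v)
    (hlen : ∀ u : ℤ →₀ K, IsTWord A u → tEval T u = tEval T v → tLength v ≤ tLength u + n)
    (F : Finset K) (p₀ : ℤ) (hF : ∀ p, p₀ ≤ p → tailEval T p v ∈ F) {i : ℤ} (hi : i ∈ v.support) :
    i ≤ p₀ + F.card * (n + 1) := by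
  classical
  by_contra! hlt
  obtain ⟨y, -, hy⟩ := Finset.exists_lt_card_fiber_of_mul_lt_card_of_maps_to
    (s := Finset.Ico p₀ i) (t := F) (n := n + 1) (f := fun p => tailEval T p v)
    (fun p hp => hF p (Finset.mem_Ico.1 hp).1) (by
      zify
      rw [Int.card_Ico, Int.toNat_of_nonneg (by nlinarith)]
      linarith)
  set S := (Finset.Ico p₀ i).filter fun p => tailEval T p v = y with hS
  have hSne : S.Nonempty := Finset.card_pos.1 (by omega)
  have hSy : ∀ p ∈ S, tailEval T p v = y := fun p hp => (Finset.mem_filter.1 hp).2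
  -- deleting a tail of value zero would contradict minimality
  have hy0 : y ≠ 0 := by
    rintro rfl
    obtain ⟨p, hp⟩ := hSne
    have h1 := tEval_filter_not_lt T p v
    rw [hSy p hp, map_zero, add_zero] at h1
    have h2 := hv.2 (v.filter fun i => ¬ p < i)
      (fun k => by rw [Finsupp.filter_apply]; split_ifs; exacts [h0, hv.1 k])
      (fun k => by rw [Finsupp.filter_apply]; split_ifs <;> simp) h1
    have hpi : p < i := (Finset.mem_Ico.1 (Finset.mem_filter.1 hp).1).2
    rw [Finsupp.mem_support_iff, ← h2, Finsupp.filter_apply, if_neg (not_not.2 hpi)] at hi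
    exact hi rfl
  set g : ℤ → ℕ := fun p => (v.support.filter (p < ·)).card with hg
  have hsub : ∀ p q : ℤ, p ≤ q → v.support.filter (q < ·) ⊆ v.support.filter (p < ·) :=
    fun p q hpq => Finset.monotone_filter_right _ fun k _ (hk : q < k) => hpq.trans_lt hk
  -- a stretch without letters between two equal tails would be a period of `y` under `T`
  have hg_lt : ∀ p ∈ S, ∀ q ∈ S, p < q → g q < g p := by
    intro p hp q hq hpq
    refine lt_of_le_of_ne (Finset.card_le_card (hsub p q hpq.le)) fun hcard => hy0 ?_
    have hset := Finset.eq_of_subset_of_card_le (hsub p q hpq.le) hcard.ge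
    have hw : v.filter (q < ·) = v.filter (p < ·) := by
      ext k
      have := Finset.ext_iff.1 hset k
      simp only [Finset.mem_filter, Finsupp.mem_support_iff] at this
      by_cases hk : v k = 0
      · simp [Finsupp.filter_apply, hk]
      · simp [Finsupp.filter_apply, show (q < k) = (p < k) by simpa [hk] using this]
    refine hper (q - p) y (by omega) ?_
    have h1 := tEval_filter_lt T q v
    rw [hw, tEval_filter_lt, hSy p hp, hSy q hq] at h1
    have h2 := congrArg (T ^ (-p)) h1
    rw [← LinearEquiv.mul_apply, ← LinearEquiv.mul_apply, ← zpow_add, ← zpow_add, neg_add_cancel,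
      zpow_zero, neg_add_eq_sub] at h2
    exact h2.symm
  have hginj : Set.InjOn g S := fun p hp q hq h => by
    rcases lt_trichotomy p q with hlt | heq | hlt
    · exact absurd h (hg_lt p hp q hq hlt).ne'
    · exact heq
    · exact absurd h (hg_lt q hq p hp hlt).ne
  set p := S.min' hSne
  set q := S.max' hSne
  have hp : p ∈ S := S.min'_mem hSne
  have hq : q ∈ S := S.max'_mem hSne
  have hcard : S.card ≤ g p + 1 - g q := by
    rw [← Finset.card_image_of_injOn hginj, ← Nat.card_Icc]
    refine Finset.card_le_card fun m hm => ?_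
    obtain ⟨k, hk, rfl⟩ := Finset.mem_image.1 hm
    exact Finset.mem_Icc.2 ⟨Finset.card_le_card (hsub _ _ (S.le_max' k hk)),
      Finset.card_le_card (hsub _ _ (S.min'_le k hk))⟩
  have h1 := hlen (excise p q v) (isTWord_excise hv.1 p q)
    (tEval_excise T p q v ((hSy p hp).trans (hSy q hq).symm))
  have h2 := tLength_excise_le p q v
  have h3 : g p + (v.support.filter fun i => ¬ p < i).card = tLength v :=
    Finset.card_filter_add_card_filter_not _
  have h4 : g q = (v.support.filter (q < ·)).card := rfl
  omega

end Pumping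

section Reversal

variable {K : Type*} [AddCommGroup K]

/-- The word `v` with `t` replaced by `t⁻¹`. -/
noncomputable def reverse (v : ℤ →₀ K) : ℤ →₀ K :=
  v.equivMapDomain (Equiv.neg ℤ)

theorem reverse_apply (v : ℤ →₀ K) (i : ℤ) : reverse v i = v (-i) := rfl

theorem reverse_reverse (v : ℤ →₀ K) : reverse (reverse v) = v := by
  ext i
  rw [reverse_apply, reverse_apply, neg_neg]

theorem tEval_reverse (T : K ≃ₗ[ℤ] K) (v : ℤ →₀ K) : tEval T⁻¹ (reverse v) = tEval T v := by
  rw [reverse, tEval, Finsupp.equivMapDomain_eq_mapDomain,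
    Finsupp.sum_mapDomain_index (fun _ => map_zero _) (fun _ => map_add _)]
  refine Finset.sum_congr rfl fun i _ => ?_
  simp only [Equiv.neg_apply, inv_zpow', neg_neg]

theorem tEval_inv (T : K ≃ₗ[ℤ] K) (v : ℤ →₀ K) : tEval T⁻¹ v = tEval T (reverse v) := by
  rw [← tEval_reverse T (reverse v), reverse_reverse]

theorem isTWord_reverse {A : Set K} {v : ℤ →₀ K} (hv : IsTWord A v) : IsTWord A (reverse v) :=
  fun i => hv (-i)

theorem tLength_reverse (v : ℤ →₀ K) : tLength (reverse v) = tLength v := by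
  simp [tLength, reverse, Finsupp.equivMapDomain]

theorem isMinimalTWord_reverse {T : K ≃ₗ[ℤ] K} {A : Set K} {v : ℤ →₀ K}
    (hv : IsMinimalTWord T A v) : IsMinimalTWord T⁻¹ A (reverse v) := by
  refine ⟨isTWord_reverse hv.1, fun u hu hsub heq => ?_⟩
  rw [← hv.2 (reverse u) (isTWord_reverse hu) (fun i => by simpa [reverse_apply] using hsub (-i))
    (by rw [← tEval_inv, heq, tEval_reverse]), reverse_reverse]

/-- The tails of the reversed word are the initial segments of the word. -/
theorem tailEval_inv_reverse (T : K ≃ₗ[ℤ] K) (p : ℤ) (v : ℤ →₀ K) :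
    tailEval T⁻¹ p (reverse v) = (T ^ p) (tEval T v) - T⁻¹ (tailEval T (-p - 1) v) := by
  have h1 : (reverse v).filter (p < ·) = reverse (v.filter fun i => ¬ (-p - 1) < i) := by
    ext i
    simp only [reverse_apply, Finsupp.filter_apply]
    exact if_congr (by omega) rfl rfl
  have h2 := tEval_filter_not_lt T (-p - 1) v
  rw [tailEval, h1, tEval_reverse, ← h2, map_add, inv_zpow', neg_neg, add_sub_assoc, left_eq_add,
    sub_eq_zero, ← LinearEquiv.mul_apply, ← zpow_add]
  congr 1
  rw [← zpow_neg_one]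
  congr 1
  ring

end Reversal

/-! ### Lattices and generalized words -/

section Lattice

/-- The supremum norm of the coordinates with respect to a basis. -/
theorem exists_lattice_seminorm (G : Type*) [AddCommGroup G] [Module.Free ℤ G] [Module.Finite ℤ G] :
    ∃ ν : AddGroupSeminorm G, (∀ (n : ℤ) x, ν (n • x) = |n| * ν x) ∧
      (∀ R : ℝ, {x | ν x ≤ R}.Finite) ∧ (∀ x, ν x = 0 → x = 0) ∧
      ∀ M : G →ₗ[ℤ] G, ∃ C : ℝ, 0 ≤ C ∧ ∀ x, ν (M x) ≤ C * ν x := by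
  classical
  set b := Module.Free.chooseBasis ℤ G
  set e : G ≃ₗ[ℤ] (Module.Free.ChooseBasisIndex ℤ G → ℤ) := b.equivFun
  set ν : AddGroupSeminorm G := (normAddGroupSeminorm (Module.Free.ChooseBasisIndex ℤ G → ℤ)).comp
    (e : G →+ (Module.Free.ChooseBasisIndex ℤ G → ℤ))
  have hν : ∀ x, ν x = ‖e x‖ := fun x => rfl
  have hsmul : ∀ (n : ℤ) x, ν (n • x) = |n| * ν x := fun n x => by
    rw [hν, hν, map_smul, norm_smul, Int.norm_eq_abs, Int.cast_abs]
  refine ⟨ν, hsmul, fun R => ?_, fun x hx => ?_, fun M => ⟨∑ i, ν (M (b i)), ?_, fun x => ?_⟩⟩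
  · have h := (isCompact_closedBall (0 : Module.Free.ChooseBasisIndex ℤ G → ℤ) R).finite_of_discrete
    refine (h.preimage e.injective.injOn).subset fun x hx => ?_
    rw [Set.mem_preimage, mem_closedBall_zero_iff, ← hν]
    exact hx
  · rwa [hν, norm_eq_zero, map_eq_zero_iff e e.injective] at hx
  · exact Finset.sum_nonneg fun i _ => apply_nonneg ν _
  · calc ν (M x) = ν (∑ i, e x i • M (b i)) := by
          conv_lhs => rw [← b.sum_equivFun x, map_sum]
          simp only [map_smul, e]
      _ ≤ ∑ i, ν (e x i • M (b i)) :=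
          Finset.le_sum_of_subadditive ν (map_zero ν).le (map_add_le_add ν) _ _
      _ ≤ ∑ i, ν x * ν (M (b i)) := by
          refine Finset.sum_le_sum fun i _ => ?_
          rw [hsmul]
          refine mul_le_mul_of_nonneg_right ?_ (apply_nonneg ν _)
          rw [hν, Int.cast_abs, ← Int.norm_eq_abs]
          exact norm_le_pi_norm (e x) i
      _ = (∑ i, ν (M (b i))) * ν x := by rw [← Finset.mul_sum, mul_comm]

end Lattice

section Restriction

variable {K : Type*} [AddCommGroup K]

/-- The restriction of `T` to a subgroup which it maps into itself. -/
noncomputable def restrictTo (T : K ≃ₗ[ℤ] K) (L : AddSubgroup K) (hTL : ∀ x ∈ L, T x ∈ L) :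
    L →ₗ[ℤ] L :=
  AddMonoidHom.toIntLinearMap
    { toFun := fun x => ⟨T x, hTL x x.2⟩
      map_zero' := Subtype.ext (map_zero T)
      map_add' := fun _ _ => Subtype.ext (map_add T _ _) }

theorem coe_restrictTo (T : K ≃ₗ[ℤ] K) (L : AddSubgroup K) (hTL : ∀ x ∈ L, T x ∈ L) (x : L) :
    (restrictTo T L hTL x : K) = T x := rfl

theorem coe_restrictTo_pow (T : K ≃ₗ[ℤ] K) (L : AddSubgroup K) (hTL : ∀ x ∈ L, T x ∈ L) (n : ℕ)
    (x : L) : ((restrictTo T L hTL ^ n) x : K) = (T ^ n) x := by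
  induction n generalizing x with
  | zero => simp
  | succ n ih => rw [pow_succ, pow_succ, Module.End.mul_apply, ih, coe_restrictTo,
      LinearEquiv.mul_apply]

/-- As `ℂ` is flat over `ℤ`, the eigenvalues of `T` on `ℂ ⊗ L` are eigenvalues on `ℂ ⊗ K`. -/
theorem IsHyperbolic.restrictTo_charpoly {T : K ≃ₗ[ℤ] K} (hT : IsHyperbolic T) {L : AddSubgroup K}
    (hTL : ∀ x ∈ L, T x ∈ L) [Module.Free ℤ L] [Module.Finite ℤ L] (z : ℂ)
    (hz : ((restrictTo T L hTL).charpoly.map (Int.castRingHom ℂ)).IsRoot z) : ‖z‖ ≠ 1 := by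
  refine hT z ?_
  rw [← algebraMap_int_eq, ← LinearMap.charpoly_baseChange,
    ← Module.End.hasEigenvalue_iff_isRoot_charpoly] at hz
  obtain ⟨x, hx⟩ := hz.exists_hasEigenvector
  set incl : L →ₗ[ℤ] K := L.subtype.toIntLinearMap
  have hinj : Function.Injective (incl.baseChange ℂ) :=
    Module.Flat.lTensor_preserves_injective_linearMap (M := ℂ) incl Subtype.val_injective
  have hcomm : (T : K →ₗ[ℤ] K) ∘ₗ incl = incl ∘ₗ restrictTo T L hTL := rfl
  refine Module.End.hasEigenvalue_of_hasEigenvector (x := incl.baseChange ℂ x)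
    ⟨Module.End.mem_eigenspace_iff.2 ?_, fun h => hx.2 (hinj (h.trans (map_zero _).symm))⟩
  rw [← LinearMap.comp_apply, ← LinearMap.baseChange_comp, hcomm, LinearMap.baseChange_comp,
    LinearMap.comp_apply, hx.apply_eq_smul, map_smul]

theorem IsHyperbolic.exists_dominant_relation {T : K ≃ₗ[ℤ] K} (hT : IsHyperbolic T)
    {L : AddSubgroup K} (hTL : ∀ x ∈ L, T x ∈ L) [Module.Free ℤ L] [Module.Finite ℤ L] :
    ∃ (q : ℤ[X]) (j : ℕ), aeval (restrictTo T L hTL) q = 0 ∧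
      ∑ i ∈ q.support.erase j, |q.coeff i| < |q.coeff j| := by
  obtain ⟨q, j, ⟨r, rfl⟩, hj⟩ := exists_dominant_multiple (restrictTo T L hTL).charpoly
    (LinearMap.charpoly_monic _) (hT.restrictTo_charpoly hTL)
  exact ⟨_, j, by rw [map_mul, LinearMap.aeval_self_charpoly, zero_mul], hj⟩

theorem sum_coeff_smul_zpow_eq_zero {T : K ≃ₗ[ℤ] K} {L : AddSubgroup K} (hTL : ∀ x ∈ L, T x ∈ L)
    (hunion : (⋃ i : ℤ, (T ^ i) '' (L : Set K)) = Set.univ) {q : ℤ[X]}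
    (hq : aeval (restrictTo T L hTL) q = 0) (k : K) :
    ∑ i ∈ q.support, q.coeff i • (T ^ (i : ℤ)) k = 0 := by
  obtain ⟨n, l, hl, rfl⟩ := Set.mem_iUnion.1 (hunion.symm ▸ Set.mem_univ k)
  have h := congrArg L.subtype (LinearMap.congr_fun hq ⟨l, hl⟩)
  rw [aeval_def, eval₂_eq_sum, sum_def] at h
  have h' : ∑ i ∈ q.support, q.coeff i • (T ^ i) l = 0 := by
    simpa [Module.algebraMap_end_apply, coe_restrictTo_pow] using h
  have h2 := congrArg (T ^ n) h'
  rw [map_zero, map_sum] at h2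
  rw [← h2]
  refine Finset.sum_congr rfl fun i _ => ?_
  rw [map_zsmul, ← LinearEquiv.mul_apply, ← LinearEquiv.mul_apply, ← zpow_natCast,
    (Commute.zpow_zpow_self T _ _).eq]

end Restriction

section Levels

theorem wordLength_le_add_excess {K : Type*} {A : Set K} (m : ℕ) (w : GenTWord A) (i : ℤ) :
    wordLength (w i) ≤ m + excess m w := by
  by_cases hi : i ∈ w.support
  · have : wordLength (w i) - m ≤ excess m w :=
      Finset.single_le_sum (f := fun i => wordLength (w i) - m) (fun _ _ => Nat.zero_le _) hi
    omega
  · rw [Finsupp.notMem_support_iff.1 hi]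
    simp [wordLength]

variable {K : Type*} [AddCommGroup K]

theorem freeEval_zero {B : Set K} : freeEval (0 : B →₀ ℤ) = 0 :=
  Finsupp.sum_zero_index

/-- The formal expression `∑ i, t ^ i * x i` in which `x i` is the sum in `K` of the letters of the
generalized `t`-word `w` at level `i`. -/
noncomputable def levelSum {A : Set K} (w : GenTWord A) : ℤ →₀ K :=
  w.mapRange freeEval freeEval_zero

theorem levelSum_apply {A : Set K} (w : GenTWord A) (i : ℤ) : levelSum w i = freeEval (w i) :=
  Finsupp.mapRange_apply

theorem tEval_levelSum (T : K ≃ₗ[ℤ] K) {A : Set K} (w : GenTWord A) :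
    tEval T (levelSum w) = genEval T w := by
  rw [tEval, levelSum, Finsupp.sum_mapRange_index (h := fun i a => (T ^ i) a) fun _ => map_zero _,
    genEval]
  refine Finset.sum_congr rfl fun i _ => ?_
  simp only [freeEval, Finsupp.sum, map_sum, map_zsmul]

theorem levelSum_mem {A : Set K} {L : AddSubgroup K} (hA : A ⊆ L) (w : GenTWord A) (i : ℤ) :
    levelSum w i ∈ L := by
  rw [levelSum_apply]
  exact sum_mem fun a _ => zsmul_mem (hA a.2) _

theorem seminorm_levelSum_le {A : Set K} {L : AddSubgroup K} (hA : A ⊆ L) (ν : AddGroupSeminorm L)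
    (hν : ∀ (n : ℤ) x, ν (n • x) = |n| * ν x) {R : ℝ} (hR : ∀ a (ha : a ∈ A), ν ⟨a, hA ha⟩ ≤ R)
    (w : GenTWord A) (i : ℤ) : ν ⟨levelSum w i, levelSum_mem hA w i⟩ ≤ wordLength (w i) * R := by
  have h : (⟨levelSum w i, levelSum_mem hA w i⟩ : L) =
      ∑ a ∈ (w i).support, w i a • (⟨a, hA a.2⟩ : L) := by
    apply Subtype.ext
    simp [levelSum_apply, freeEval, Finsupp.sum]
  rw [h, wordLength, Finsupp.sum, Nat.cast_sum, Finset.sum_mul]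
  refine (Finset.le_sum_of_subadditive ν (map_zero ν).le (map_add_le_add ν) _ _).trans
    (Finset.sum_le_sum fun a _ => ?_)
  rw [hν, Nat.cast_natAbs]
  exact mul_le_mul_of_nonneg_left (hR a a.2) (by positivity)

end Levels

/-! ### The logarithmic bound -/

section TailBound

variable {K : Type*} [AddCommGroup K]

theorem tailEval_recurrence (T : K ≃ₗ[ℤ] K) {L : AddSubgroup K} (hTL : ∀ x ∈ L, T x ∈ L)
    {c : ℤ →₀ K} (hc : ∀ i, c i ∈ L) (p : ℤ) :
    (⟨tailEval T p c, tailEval_mem T hTL hc p⟩ : L) = restrictTo T L hTL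
      (⟨tailEval T (p + 1) c, tailEval_mem T hTL hc (p + 1)⟩ + ⟨c (p + 1), hc (p + 1)⟩) :=
  Subtype.ext (tailEval_eq_apply T p c)

theorem exists_tailEval_bound (T : K ≃ₗ[ℤ] K) {L : AddSubgroup K} (hTL : ∀ x ∈ L, T x ∈ L)
    {c : ℤ →₀ K} (hc : ∀ i, c i ∈ L) (h0 : tEval T c = 0) (ν : AddGroupSeminorm L) :
    ∃ S : ℝ, ∀ p, ν ⟨tailEval T p c, tailEval_mem T hTL hc p⟩ ≤ S := by
  obtain ⟨a, ha⟩ := c.support.bddBelow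
  obtain ⟨b, hb⟩ := c.support.bddAbove
  obtain ⟨S, hS⟩ := ((Finset.Icc (a - 1) b).image fun p =>
    ν ⟨tailEval T p c, tailEval_mem T hTL hc p⟩).bddAbove
  refine ⟨max S 0, fun p => ?_⟩
  have hzero : tailEval T p c = 0 → ν ⟨tailEval T p c, tailEval_mem T hTL hc p⟩ ≤ max S 0 := by
    intro h
    have : (⟨tailEval T p c, tailEval_mem T hTL hc p⟩ : L) = 0 := Subtype.ext h
    rw [this, map_zero]
    exact le_max_right _ _
  by_cases h1 : p < a
  · exact hzero (by rw [tailEval_eq_tEval T fun i hi => h1.trans_le (ha hi), h0, map_zero])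
  by_cases h2 : b < p
  · exact hzero (tailEval_eq_zero T fun i hi => (hb hi).trans h2.le)
  exact (hS (Finset.mem_coe.2 (Finset.mem_image_of_mem _ (Finset.mem_Icc.2 (by omega))))).trans
    (le_max_left _ _)

/-- A hyperbolic automorphism has no nonzero periodic points: a periodic orbit in `L` is a bounded
solution of the homogeneous recurrence, hence zero. -/
theorem eq_zero_of_zpow_apply_eq {T : K ≃ₗ[ℤ] K} (hT : IsHyperbolic T)
    {L : AddSubgroup K} (hTL : ∀ x ∈ L, T x ∈ L) [Module.Free ℤ L] [Module.Finite ℤ L]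
    (hunion : (⋃ i : ℤ, (T ^ i) '' (L : Set K)) = Set.univ) {k : ℤ} (hk : 0 < k) {y : K}
    (hy : (T ^ k) y = y) : y = 0 := by
  obtain ⟨n, l, hl, rfl⟩ := Set.mem_iUnion.1 (hunion.symm ▸ Set.mem_univ y)
  have hl' : (T ^ k) l = l := by
    apply (T ^ n).injective
    rw [← LinearEquiv.mul_apply, (Commute.zpow_zpow_self T n k).eq, LinearEquiv.mul_apply, hy]
  obtain ⟨ν, hν, -, hν0, hνM⟩ := exists_lattice_seminorm L
  obtain ⟨C, hC, hM⟩ := hνM (restrictTo T L hTL)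
  obtain ⟨q, j, hq, hj⟩ := hT.exists_dominant_relation hTL
  obtain ⟨θ, C₁, D, -, -, -, h⟩ := exists_recurrence_bound ν hν _ hC hM q hq j hj
  -- the orbit of `l` as a function of the exponent modulo `k`
  have hmod : ∀ p : ℤ, (T ^ p) l = (T ^ (p % k)) l := fun p => by
    have hfix : ∀ m : ℤ, (T ^ (k * m)) l = l := fun m => by
      rw [zpow_mul]
      exact zpow_mem (S := Subgroup (K ≃ₗ[ℤ] K)) (K := MulAction.stabilizer (K ≃ₗ[ℤ] K) l) hl' m
    conv_lhs => rw [← Int.emod_add_mul_ediv p k, zpow_add, LinearEquiv.mul_apply, hfix]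
  have hmem : ∀ p : ℤ, (T ^ p) l ∈ L := fun p => by
    rw [hmod]
    obtain ⟨m, hm⟩ := Int.eq_ofNat_of_zero_le (Int.emod_nonneg p hk.ne')
    rw [hm, zpow_natCast, ← coe_restrictTo_pow T L hTL m ⟨l, hl⟩]
    exact Subtype.property _
  obtain ⟨S, hS⟩ := ((Finset.Ico 0 k).image fun p => ν ⟨(T ^ p) l, hmem p⟩).bddAbove
  have h2 := (h (fun p => ⟨(T ^ (-p)) l, hmem (-p)⟩) 0 (fun p => Subtype.ext (by
      rw [Pi.zero_apply, add_zero, coe_restrictTo]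
      change (T ^ (-p)) l = T ((T ^ (-(p + 1))) l)
      rw [← LinearEquiv.mul_apply, ← zpow_one_add]
      congr 2
      ring))
    ⟨S, fun p => by
      refine hS (Finset.mem_coe.2 (Finset.mem_image.2 ⟨(-p) % k, Finset.mem_Ico.2
        ⟨Int.emod_nonneg _ hk.ne', Int.emod_lt_of_pos _ hk⟩, ?_⟩))
      simp only [← hmod]⟩ 0 (by simp)).1 0
  have h3 := hν0 _ (le_antisymm (h2.trans (by simp)) (apply_nonneg ν _))
  have h4 : l = 0 := by simpa using congrArg Subtype.val h3
  rw [h4, map_zero]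

/-- Far from the levels of `w`, the tails of `v - w` lie in a finite set that does not depend on `v`
and `w`, where the distance required is logarithmic in the excess of `w`. -/
theorem exists_finset_tailEval_mem {T : K ≃ₗ[ℤ] K} (hT : IsHyperbolic T)
    {L : AddSubgroup K} (hTL : ∀ x ∈ L, T x ∈ L) [Module.Free ℤ L] [Module.Finite ℤ L]
    {A : Set K} (hAfin : A.Finite) (hA : A ⊆ L) (m : ℕ) :
    ∃ (F : Finset K) (D : ℕ) (θ : ℝ), 0 < θ ∧ θ < 1 ∧ ∀ (w : GenTWord A) (v : ℤ →₀ K),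
      IsTWord A v → tEval T v = genEval T w → ∀ r : ℕ, θ ^ r * (excess m w + 1) ≤ 1 →
      ∀ p : ℤ, (∀ i ∈ w.support, D * r < |i - p|) → tailEval T p (v - levelSum w) ∈ F := by
  classical
  obtain ⟨ν, hν, hfin, -, hνM⟩ := exists_lattice_seminorm L
  obtain ⟨C, hC, hM⟩ := hνM (restrictTo T L hTL)
  obtain ⟨q, j, hq, hj⟩ := hT.exists_dominant_relation hTL
  obtain ⟨θ, C₁, D, hθ, hθ1, hC₁, h⟩ := exists_recurrence_bound ν hν _ hC hM q hq j hj
  obtain ⟨R₀, hR₀0, hR₀⟩ : ∃ R : ℝ, 0 ≤ R ∧ ∀ a (ha : a ∈ A), ν ⟨a, hA ha⟩ ≤ R := by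
    have := hAfin.to_subtype
    obtain ⟨R, hR⟩ := (Set.finite_range fun a : A => ν ⟨a, hA a.2⟩).bddAbove
    exact ⟨max R 0, le_max_right _ _, fun a ha => (hR ⟨⟨a, ha⟩, rfl⟩).trans (le_max_left _ _)⟩
  -- the ball of radius `C₁ * R₀ * (m + 2)` contains all tails far from the support of `w`
  refine ⟨(hfin (C₁ * R₀ * (m + 2))).toFinset.image (↑), D, max θ 2⁻¹, by positivity,
    max_lt hθ1 (by norm_num), fun w v hv hvw r hr p hp => ?_⟩
  set c : ℤ →₀ K := v - levelSum w with hcdef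
  have hc : ∀ i, c i ∈ L := fun i => sub_mem (hA (hv i)) (levelSum_mem hA w i)
  have h0 : tEval T c = 0 := by rw [hcdef, tEval_sub, tEval_levelSum, hvw, sub_self]
  set e : ℝ := ((excess m w : ℕ) : ℝ) with he
  have he0 : 0 ≤ e := Nat.cast_nonneg _
  have hcbd : ∀ i, ν ⟨c i, hc i⟩ ≤ R₀ * (m + 1) * (e + 1) := fun i => by
    have h1 : (⟨c i, hc i⟩ : L) = ⟨v i, hA (hv i)⟩ - ⟨levelSum w i, levelSum_mem hA w i⟩ := rfl
    have h2 := seminorm_levelSum_le hA ν hν hR₀ w i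
    have h3 : (wordLength (w i) : ℝ) ≤ m + e := by
      rw [he]
      exact_mod_cast wordLength_le_add_excess m w i
    have h4 := mul_le_mul_of_nonneg_right h3 hR₀0
    have h5 : 0 ≤ R₀ * (m * e) := by positivity
    rw [h1]
    refine (map_sub_le_add ν _ _).trans ?_
    have := hR₀ _ (hv i)
    nlinarith
  have hmain := (h (fun p => ⟨tailEval T p c, tailEval_mem T hTL hc p⟩) (fun i => ⟨c i, hc i⟩)
    (tailEval_recurrence T hTL hc) (exists_tailEval_bound T hTL hc h0 ν) _ hcbd).2 R₀ r p
    fun i hi => by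
      have hwi : w i = 0 := by
        by_contra hne
        exact (hp i (Finsupp.mem_support_iff.2 hne)).not_ge hi
      have h1 : (⟨c i, hc i⟩ : L) = ⟨v i, hA (hv i)⟩ := Subtype.ext (by
        change v i - levelSum w i = v i
        rw [levelSum_apply, hwi, freeEval_zero, sub_zero])
      rw [h1]
      exact hR₀ _ (hv i)
  refine Finset.mem_image.2 ⟨⟨tailEval T p c, tailEval_mem T hTL hc p⟩, ?_, rfl⟩
  rw [Set.Finite.mem_toFinset]
  have hθr : θ ^ r * (e + 1) ≤ 1 := le_trans (by gcongr; exact le_max_left _ _) hr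
  have h6 : 0 ≤ C₁ * (R₀ * (m + 1)) := by positivity
  calc ν ⟨tailEval T p c, tailEval_mem T hTL hc p⟩
      ≤ θ ^ r * (C₁ * (R₀ * (m + 1) * (e + 1))) + C₁ * R₀ := hmain
    _ = C₁ * (R₀ * (m + 1)) * (θ ^ r * (e + 1)) + C₁ * R₀ := by ring
    _ ≤ C₁ * (R₀ * (m + 1)) * 1 + C₁ * R₀ := by gcongr
    _ = C₁ * R₀ * (m + 2) := by ring

theorem exists_nat_pow_mul_le_one {θ : ℝ} (h0 : 0 < θ) (h1 : θ < 1) {x : ℝ} (hx : 1 ≤ x) :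
    ∃ r : ℕ, θ ^ r * x ≤ 1 ∧ (r : ℝ) < Real.log x / -Real.log θ + 1 := by
  have hlog : 0 < -Real.log θ := neg_pos.2 (Real.log_neg h0 h1)
  have hx0 : 0 < x := by linarith
  refine ⟨⌈Real.log x / -Real.log θ⌉₊, ?_, Nat.ceil_lt_add_one
    (div_nonneg (Real.log_nonneg hx) hlog.le)⟩
  have h := Nat.le_ceil (Real.log x / -Real.log θ)
  rw [div_le_iff₀ hlog] at h
  rw [← Real.log_nonpos_iff (by positivity), Real.log_mul (by positivity) hx0.ne', Real.log_pow]
  linarith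

end TailBound

section Exponents

theorem iMax_sub_iMax_lt {M N : Type*} [Zero M] [Zero N] {w : ℤ →₀ M} (hw : w ≠ 0) (v : ℤ →₀ N)
    {b β : ℝ} (hb : b < β)
    (h : ∀ I : ℤ, (∀ k ∈ w.support, k ≤ I) → ∀ i ∈ v.support, (i : ℝ) ≤ I + b) :
    iMax v - iMax w < (β : EReal) := by
  have hne : w.support.Nonempty := Finsupp.support_nonempty_iff.2 hw
  set I := w.support.max' hne
  have h1 : ((I : ℝ) : EReal) ≤ iMax w :=
    le_iSup₂_of_le I (w.support.max'_mem hne) le_rfl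
  have h2 : iMax v ≤ ((I + b : ℝ) : EReal) := iSup₂_le fun i hi =>
    EReal.coe_le_coe_iff.2 (h I (fun k hk => w.support.le_max' k hk) i hi)
  refine (EReal.sub_le_sub h2 h1).trans_lt ?_
  rw [← EReal.coe_sub, add_sub_cancel_left]
  exact EReal.coe_lt_coe_iff.2 hb

theorem iMin_sub_iMin_lt {M N : Type*} [Zero M] [Zero N] {w : ℤ →₀ M} (hw : w ≠ 0) (v : ℤ →₀ N)
    {b β : ℝ} (hb : b < β)
    (h : ∀ I : ℤ, (∀ k ∈ w.support, I ≤ k) → ∀ i ∈ v.support, (I : ℝ) - b ≤ i) :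
    iMin w - iMin v < (β : EReal) := by
  have hne : w.support.Nonempty := Finsupp.support_nonempty_iff.2 hw
  set I := w.support.min' hne
  have h1 : iMin w ≤ ((I : ℝ) : EReal) :=
    iInf₂_le_of_le I (w.support.min'_mem hne) le_rfl
  have h2 : ((I - b : ℝ) : EReal) ≤ iMin v := le_iInf₂ fun i hi =>
    EReal.coe_le_coe_iff.2 (h I (fun k hk => w.support.min'_le k hk) i hi)
  refine (EReal.sub_le_sub h1 h2).trans_lt ?_
  rw [← EReal.coe_sub, sub_sub_cancel]
  exact EReal.coe_lt_coe_iff.2 hb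

end Exponents

section Main

variable {K : Type*} [AddCommGroup K]

/-- The logarithmic bounds hold for every finite set `A ⊆ L` that contains `0`. -/
theorem exists_log_bound {T : K ≃ₗ[ℤ] K} (hT : IsHyperbolic T)
    {L : AddSubgroup K} (hTL : ∀ x ∈ L, T x ∈ L) [Module.Free ℤ L] [Module.Finite ℤ L]
    (hunion : (⋃ i : ℤ, (T ^ i) '' (L : Set K)) = Set.univ)
    {A : Set K} (hAfin : A.Finite) (hA : A ⊆ L) (hA0 : (0 : K) ∈ A) (m n : ℕ) :
    ∃ B C : ℤ, ∀ w : GenTWord A, w ≠ 0 →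
    ∀ w' : ℤ →₀ K, IsMinimalTWord T A w' → tEval T w' = genEval T w →
      (∀ v : ℤ →₀ K, IsTWord A v → tEval T v = genEval T w → tLength w' ≤ tLength v + n) →
      iMax w' - iMax w < ((B * Real.log (excess m w + 1) + C : ℝ) : EReal) ∧
      iMin w - iMin w' < ((B * Real.log (excess m w + 1) + C : ℝ) : EReal) := by
  classical
  obtain ⟨F, D, θ, hθ0, hθ1, hF⟩ := exists_finset_tailEval_mem hT hTL hAfin hA m
  have hper : ∀ (k : ℤ) (y : K), 0 < k → (T ^ k) y = y → y = 0 := fun k y hk hy =>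
    eq_zero_of_zpow_apply_eq hT hTL hunion hk hy
  have hper' : ∀ (k : ℤ) (y : K), 0 < k → (T⁻¹ ^ k) y = y → y = 0 := fun k y hk hy => by
    refine hper k y hk ?_
    conv_lhs => rw [← hy]
    rw [← LinearEquiv.mul_apply, inv_zpow, mul_inv_cancel]
    rfl
  refine ⟨⌈D / -Real.log θ⌉, D + 2 + F.card * (n + 1), fun w hw v hv hvw hlen => ?_⟩
  have hx : (1 : ℝ) ≤ excess m w + 1 := by simp
  obtain ⟨r, hr, hr'⟩ := exists_nat_pow_mul_le_one hθ0 hθ1 hx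
  have hb : (D * r + 1 + F.card * (n + 1) : ℝ) < (⌈D / -Real.log θ⌉ : ℤ) *
      Real.log (excess m w + 1) + ((D + 2 + F.card * (n + 1) : ℤ) : ℝ) := by
    have h1 : (D * r : ℝ) ≤ D * (Real.log (excess m w + 1) / -Real.log θ + 1) := by gcongr
    have h2 : D * (Real.log (excess m w + 1) / -Real.log θ + 1) =
        D / -Real.log θ * Real.log (excess m w + 1) + D := by ring
    have h3 : D / -Real.log θ * Real.log (excess m w + 1) ≤
        (⌈D / -Real.log θ⌉ : ℤ) * Real.log (excess m w + 1) :=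
      mul_le_mul_of_nonneg_right (Int.le_ceil _) (Real.log_nonneg hx)
    push_cast
    linarith
  have hF' := hF w v hv.1 hvw r hr
  constructor
  · refine iMax_sub_iMax_lt hw v hb fun I hI i hi => ?_
    have key := le_of_mem_support_of_tailEval_mem hper hA0 hv
      (fun u hu huv => hlen u hu (huv.trans hvw)) F (I + D * r + 1) (fun p hp => by
        have h1 := hF' p fun k hk => by
          have := hI k hk
          rw [abs_sub_comm]
          exact lt_of_lt_of_le (by omega) (le_abs_self _)
        rwa [tailEval_sub, tailEval_eq_zero T (v := levelSum w) fun k hk => by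
          have := hI k (Finsupp.support_mapRange hk)
          have : (0 : ℤ) ≤ D * r := by positivity
          omega, sub_zero] at h1) hi
    have key' : (i : ℝ) ≤ ((I + D * r + 1 + F.card * (n + 1) : ℤ) : ℝ) := by exact_mod_cast key
    push_cast at key'
    linarith
  · refine iMin_sub_iMin_lt hw v hb fun I hI i hi => ?_
    have key := le_of_mem_support_of_tailEval_mem hper' hA0 (isMinimalTWord_reverse hv)
      (fun u hu huv => by
        rw [tLength_reverse, ← tLength_reverse u]
        refine hlen _ (isTWord_reverse hu) ?_
        rw [← tEval_inv, huv, tEval_reverse, hvw])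
      (F.image fun x => -(T⁻¹ x)) (-I + D * r) (fun p hp => by
        have hDr : (0 : ℤ) ≤ D * r := by positivity
        refine Finset.mem_image.2 ⟨_, hF' (-p - 1) fun k hk => ?_, ?_⟩
        · have := hI k hk
          exact lt_of_lt_of_le (by omega) (le_abs_self _)
        · have hlow : ∀ k ∈ (levelSum w).support, -p - 1 < k := fun k hk => by
            have := hI k (Finsupp.support_mapRange hk)
            omega
          rw [tailEval_inv_reverse, tailEval_sub, tailEval_eq_tEval T hlow, tEval_levelSum, ← hvw,
            map_sub, ← LinearEquiv.mul_apply T⁻¹ (T ^ _), ← zpow_neg_one, ← zpow_add]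
          have : -1 + -(-p - 1) = p := by ring
          rw [this]
          abel)
      (i := -i) (by
        rw [Finsupp.mem_support_iff, reverse_apply, neg_neg]
        exact Finsupp.mem_support_iff.1 hi)
    have key' : ((-i : ℤ) : ℝ) ≤
        ((-I + D * r + (F.image fun x : K => -(T⁻¹ x)).card * (n + 1) : ℤ) : ℝ) := by
      exact_mod_cast key
    have hcard : ((F.image fun x : K => -(T⁻¹ x)).card : ℝ) * (n + 1) ≤ F.card * (n + 1) :=
      mul_le_mul_of_nonneg_right (Nat.cast_le.2 Finset.card_image_le) (by positivity)
    push_cast at key'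
    linarith

theorem isStronglyTLogarithmic_coefficientBox {T : K ≃ₗ[ℤ] K} (hT : IsHyperbolic T)
    {L : AddSubgroup K} (hTL : ∀ x ∈ L, T x ∈ L) [Module.Free ℤ L] [Module.Finite ℤ L]
    (hunion : (⋃ i : ℤ, (T ^ i) '' (L : Set K)) = Set.univ)
    {A : Finset K} (hA : AddSubgroup.closure (A : Set K) = L) {N : ℕ}
    (hN : BoundsCoefficients T (A : Set K) N) :
    IsStronglyTLogarithmic T (coefficientBox A N) where
  zero_mem := zero_mem_coefficientBox hN
  symmetrized a := ⟨neg_mem_coefficientBox, fun h => by simpa using neg_mem_coefficientBox h⟩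
  generating := isTGenerating_coefficientBox (hA.symm ▸ hunion) hN
  log_bound m n _ := by
    refine exists_log_bound hT hTL hunion (finite_coefficientBox A N) ?_
      (zero_mem_coefficientBox hN) m n
    rintro _ ⟨c, -, rfl⟩
    exact sum_mem fun a ha => zsmul_mem (hA ▸ AddSubgroup.subset_closure ha) _

end Main

end TLog

theorem mainTheorem4 {K : Type*} [AddCommGroup K] [IsAddTorsionFree K] [Nontrivial K]
    (hrank : Module.rank ℤ K < Cardinal.aleph0)
    (T : K ≃ₗ[ℤ] K) (hT : TLog.IsHyperbolic T)
    (L : AddSubgroup K) (hLfg : L.FG) (hLrank : Module.rank ℤ L = Module.rank ℤ K)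
    (hTL : ∀ x ∈ L, T x ∈ L)
    (hunion : (⋃ i : ℤ, (T ^ i) '' (L : Set K)) = Set.univ) :
    (∃ A : Set K, A.Finite ∧ TLog.IsStronglyTLogarithmic T A) ∧
    ∀ A : Finset K, LinearIndepOn ℤ id (A : Set K) → AddSubgroup.closure (A : Set K) = L →
      (∃ N : ℕ, TLog.BoundsCoefficients T (A : Set K) N) ∧
      ∀ N : ℕ, TLog.BoundsCoefficients T (A : Set K) N →
        (TLog.coefficientBox A N).Finite ∧
        TLog.IsStronglyTLogarithmic T (TLog.coefficientBox A N) := by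
  have : Module.Finite ℤ L :=
    Module.Finite.iff_addGroup_fg.2 ((AddGroup.fg_iff_addSubgroup_fg L).2 hLfg)
  obtain ⟨q, j, hq, hj⟩ := hT.exists_dominant_relation hTL
  have hbound := TLog.boundsCoefficients_of_dominant T q
    (TLog.sum_coeff_smul_zpow_eq_zero hTL hunion hq) j hj
  refine ⟨?_, fun A _ hA => ⟨⟨_, hbound A⟩, fun N hN => ⟨TLog.finite_coefficientBox A N,
    TLog.isStronglyTLogarithmic_coefficientBox hT hTL hunion hA hN⟩⟩⟩
  obtain ⟨A, hA⟩ := hLfg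
  exact ⟨_, TLog.finite_coefficientBox A _,
    TLog.isStronglyTLogarithmic_coefficientBox hT hTL hunion hA (hbound A)⟩
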